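/- Let $M$ be a 2-connected smooth manifold (that is, $M$ is non-empty and path-connected, with $\pi_1(M)=\pi_2(M)=0$) with a fixed base point $x\in M$, and let $X$ be any smooth manifold. Let $\mathrm{U}(1)^M$ be the abelian group of smooth maps $M\to\mathrm{U}(1)$ under pointwise multiplication, regarded as a diffeological group with the mapping space diffeology: a map $f\colon\mathbb{R}^n\to \mathrm{U}(1)^M$ is a plot if and only if $\mathbb{R}^n\times M\to\mathrm{U}(1)$, $(t,y)\mapsto f(t)(y)$, is smooth. For a commutative diffeological group $A$ let $\check{\mathrm{H}}{}^k(X;A)$ denote the Čech cohomology of $X$ (the direct limit over all open covers of $X$, ordered by refinement) with coefficients in the sheaf of smooth $A$-valued functions, $U\mapsto C^\infty(U,A)$, on $X$. Then for every $k>0$ the homomorphism $$\check{\mathrm{H}}{}^k(X;\mathrm{U}(1)^M)\longrightarrow\check{\mathrm{H}}{}^k(X;\mathrm{U}(1))$$ induced by the evaluation $\mathrm{ev}_x\colon \mathrm{U}(1)^M\to\mathrm{U}(1)$, $g\mapsto g(x)$, is an isomorphism. Here manifolds are finite-dimensional, Hausdorff, second countable and without boundary. -/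

import Mathlib

open scoped Manifold ContDiff Topology
open TopologicalSpace Diffeology

universe u v w

/-! ## Diffeological spaces -/

/-- The diffeology of a (finite-dimensional, boundaryless) smooth manifold: the plots are the maps
`ℝᵏ → M` that are smooth as maps of manifolds. -/
@[reducible]
def manifoldDiffeology (n : ℕ) (M : Type*) [TopologicalSpace M]
    [ChartedSpace (EuclideanSpace ℝ (Fin n)) M] : DiffeologicalSpace M where
  plots k := {p | ContMDiff (𝓡 k) (𝓡 n) ∞ p}
  constant_plots _ := contMDiff_const
  plot_reparam hp hf := ContMDiff.comp hp hf.contMDiff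
  locality {k p} h := by
    intro t
    obtain ⟨u, hu, htu, hplot⟩ := h t
    obtain ⟨ε, hε, hball⟩ := Metric.isOpen_iff.mp hu t htu
    have h1 : ContMDiff (𝓡 k) (𝓡 n) ∞ (p ∘ OpenPartialHomeomorph.univBall t ε) := by
      refine hplot (fun y => hball ?_) OpenPartialHomeomorph.contDiff_univBall
      have := (OpenPartialHomeomorph.univBall t ε).map_source (x := y)
      rw [OpenPartialHomeomorph.univBall_target t hε] at this
      exact this (by simp)
    have h2 : ContMDiffOn (𝓡 k) (𝓡 k) ∞ (OpenPartialHomeomorph.univBall t ε).symm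
        (Metric.ball t ε) :=
      (OpenPartialHomeomorph.contDiffOn_univBall_symm (c := t) (r := ε)).contMDiffOn
    have h3 := h1.comp_contMDiffOn h2
    have h4 : ContMDiffAt (𝓡 k) (𝓡 n) ∞ ((p ∘ OpenPartialHomeomorph.univBall t ε) ∘
        (OpenPartialHomeomorph.univBall t ε).symm) t :=
      h3.contMDiffAt (Metric.ball_mem_nhds t hε)
    refine h4.congr_of_eventuallyEq ?_
    filter_upwards [Metric.ball_mem_nhds t hε] with y hy
    have : y ∈ (OpenPartialHomeomorph.univBall t ε).target := by
      rwa [OpenPartialHomeomorph.univBall_target t hε]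
    simp [(OpenPartialHomeomorph.univBall t ε).right_inv this]

/-- The subspace diffeology. -/
instance subtypeDiffeology {X : Type*} [DiffeologicalSpace X] (s : X → Prop) :
    DiffeologicalSpace (Subtype s) where
  plots _ := {p | IsPlot (fun t => (p t : X))}
  constant_plots _ := isPlot_const
  plot_reparam hp hf := isPlot_reparam hp hf
  locality h := DiffeologicalSpace.locality h

/-- The product diffeology. -/
instance prodDiffeology {X Y : Type*} [DiffeologicalSpace X] [DiffeologicalSpace Y] :
    DiffeologicalSpace (X × Y) where
  plots _ := {p | IsPlot (fun t => (p t).1) ∧ IsPlot (fun t => (p t).2)}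
  constant_plots _ := ⟨isPlot_const, isPlot_const⟩
  plot_reparam hp hf := ⟨isPlot_reparam hp.1 hf, isPlot_reparam hp.2 hf⟩
  locality h := by
    refine ⟨DiffeologicalSpace.locality fun t => ?_, DiffeologicalSpace.locality fun t => ?_⟩
    · obtain ⟨u, hu, htu, hp⟩ := h t
      exact ⟨u, hu, htu, fun hf hfs => (hp hf hfs).1⟩
    · obtain ⟨u, hu, htu, hp⟩ := h t
      exact ⟨u, hu, htu, fun hf hfs => (hp hf hfs).2⟩

/-- The set `Yˣ` of smooth maps from `X` to `Y`. -/
@[ext]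
structure DMap (X Y : Type*) [DiffeologicalSpace X] [DiffeologicalSpace Y] where
  /-- the underlying function -/
  toFun : X → Y
  /-- the underlying function is smooth -/
  smooth : DSmooth toFun

/-- The mapping space diffeology on `Yˣ`: a map `f : ℝᵏ → Yˣ` is a plot if and only if
`ℝᵏ × X → Y`, `(t, x) ↦ f t x`, is smooth. -/
instance mappingSpaceDiffeology {X Y : Type*} [DiffeologicalSpace X] [DiffeologicalSpace Y] :
    DiffeologicalSpace (DMap X Y) where
  plots k := {p | DSmooth (fun q : EuclideanSpace ℝ (Fin k) × X => (p q.1).toFun q.2)}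
  constant_plots f := fun n p hp => f.smooth n _ hp.2
  plot_reparam {n m p g} hp hg := fun l q hq =>
    hp l (fun t => (g (q t).1, (q t).2)) ⟨ContDiff.isPlot (hg.comp (IsPlot.contDiff hq.1)), hq.2⟩
  locality {k p} h := by
    intro l q hq
    have hq1 : ContDiff ℝ ∞ (fun t => (q t).1) := IsPlot.contDiff hq.1
    refine DiffeologicalSpace.locality fun t => ?_
    obtain ⟨u, hu, htu, hp⟩ := h (q t).1
    refine ⟨(fun t => (q t).1) ⁻¹' u, hu.preimage hq1.continuous, htu, fun {r f} hf hfs => ?_⟩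
    have := hp (f := fun y => (q (f y)).1) (fun y => hf y) (hq1.comp hfs)
    exact this r (fun y => (y, (q (f y)).2)) ⟨isPlot_id, isPlot_reparam hq.2 hfs⟩

/-- A commutative group with a diffeology is a diffeological group if multiplication and inversion
are smooth. -/
class IsDiffeologicalGroup (A : Type*) [CommGroup A] [DiffeologicalSpace A] : Prop where
  smooth_mul : DSmooth (fun p : A × A => p.1 * p.2)
  smooth_inv : DSmooth (fun a : A => a⁻¹)

namespace DMap

variable {X : Type*} {A : Type*} [DiffeologicalSpace X] [CommGroup A] [DiffeologicalSpace A]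
  [IsDiffeologicalGroup A]

instance : One (DMap X A) := ⟨⟨fun _ => 1, dSmooth_const⟩⟩

instance : Mul (DMap X A) := ⟨fun f g => ⟨fun x => f.toFun x * g.toFun x, fun n p hp =>
  IsDiffeologicalGroup.smooth_mul n (fun t => (f.toFun (p t), g.toFun (p t)))
    ⟨f.smooth n p hp, g.smooth n p hp⟩⟩⟩

instance : Inv (DMap X A) := ⟨fun f => ⟨fun x => (f.toFun x)⁻¹, fun n p hp =>
  IsDiffeologicalGroup.smooth_inv n _ (f.smooth n p hp)⟩⟩

/-- Smooth maps into a commutative diffeological group form a group under pointwise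
multiplication. -/
instance : CommGroup (DMap X A) where
  mul_assoc f g h := DMap.ext (funext fun _ => mul_assoc _ _ _)
  one_mul f := DMap.ext (funext fun _ => one_mul _)
  mul_one f := DMap.ext (funext fun _ => mul_one _)
  inv_mul_cancel f := DMap.ext (funext fun _ => inv_mul_cancel _)
  mul_comm f g := DMap.ext (funext fun _ => mul_comm _ _)

/-- The mapping space `Aˣ` is again a diffeological group. -/
instance : IsDiffeologicalGroup (DMap X A) where
  smooth_mul := fun _ _ hp l q hq =>
    IsDiffeologicalGroup.smooth_mul l (fun _ => (_, _)) ⟨hp.1 l q hq, hp.2 l q hq⟩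
  smooth_inv := fun _ _ hp l q hq => IsDiffeologicalGroup.smooth_inv l _ (hp l q hq)

/-- Evaluation at a point `x`, as a homomorphism `Aˣ → A`. -/
def evalHom (A : Type*) [CommGroup A] [DiffeologicalSpace A] [IsDiffeologicalGroup A] (x : X) :
    DMap X A →* A where
  toFun f := f.toFun x
  map_one' := rfl
  map_mul' _ _ := rfl

theorem dSmooth_evalHom (x : X) : DSmooth (evalHom A x) := fun n _ hp =>
  hp n (fun t => (t, x)) ⟨isPlot_id, isPlot_const⟩

end DMap

/-- `U(1)` with its standard diffeology as a one-dimensional manifold. -/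
noncomputable instance circleDiffeology : DiffeologicalSpace Circle := manifoldDiffeology 1 Circle

instance : IsDiffeologicalGroup Circle where
  smooth_mul := fun k p hp => by
    have h₁ : ContMDiff (𝓡 k) (𝓡 1) ∞ (fun t => (p t).1) := hp.1
    have h₂ : ContMDiff (𝓡 k) (𝓡 1) ∞ (fun t => (p t).2) := hp.2
    exact h₁.mul h₂
  smooth_inv := fun k p hp => by
    have h : ContMDiff (𝓡 k) (𝓡 1) ∞ p := hp
    exact h.inv

/-! ## The sheaf of smooth functions with values in a diffeological group -/

section SmoothFunctions

open CategoryTheory Opposite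

/-- Restriction of smooth maps along an inclusion of open subsets. -/
def DMap.restrict {X : Type*} [TopologicalSpace X] [DiffeologicalSpace X] {A : Type*} [CommGroup A]
    [DiffeologicalSpace A] [IsDiffeologicalGroup A] {U V : Opens X} (h : V ≤ U) :
    DMap U A →* DMap V A where
  toFun f := ⟨fun y => f.toFun ⟨y, h y.2⟩, fun n p hp => f.smooth n (fun t => ⟨p t, h (p t).2⟩) hp⟩
  map_one' := rfl
  map_mul' _ _ := rfl

/-- The sheaf of abelian groups `U ↦ C^∞(U, A)` on `X`, for a commutative diffeological group `A`;
open sets carry the subspace diffeology. (The group structure is written additively.) -/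
def smoothFunctions (X : Type u) [TopologicalSpace X] [DiffeologicalSpace X] (A : Type v)
    [CommGroup A] [DiffeologicalSpace A] [IsDiffeologicalGroup A] :
    (Opens X)ᵒᵖ ⥤ AddCommGrpCat.{max u v} where
  obj U := AddCommGrpCat.of (Additive (DMap U.unop A))
  map i := AddCommGrpCat.ofHom (MonoidHom.toAdditive (DMap.restrict (leOfHom i.unop)))
  map_id _ := rfl
  map_comp _ _ := rfl

/-- Composition of smooth maps with a smooth homomorphism of diffeological groups. -/
def DMap.compLeft (Y : Type*) [DiffeologicalSpace Y] {A B : Type*}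
    [CommGroup A] [DiffeologicalSpace A] [IsDiffeologicalGroup A]
    [CommGroup B] [DiffeologicalSpace B] [IsDiffeologicalGroup B] (φ : A →* B) (hφ : DSmooth φ) :
    DMap Y A →* DMap Y B where
  toFun f := ⟨fun y => φ (f.toFun y), hφ.comp f.smooth⟩
  map_one' := DMap.ext (funext fun _ => map_one φ)
  map_mul' _ _ := DMap.ext (funext fun _ => map_mul φ _ _)

/-- The morphism from the sheaf of smooth `Aᴹ`-valued functions on `X` to the sheaf of smooth
`A`-valued functions on `X` given by evaluation at `x ∈ M`. -/
def evalSmoothFunctions (X M : Type u) [TopologicalSpace X] [DiffeologicalSpace X]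
    [DiffeologicalSpace M] (A : Type) [CommGroup A] [DiffeologicalSpace A]
    [IsDiffeologicalGroup A] (x : M) :
    smoothFunctions X (DMap M A) ⟶ smoothFunctions X A where
  app U := AddCommGrpCat.ofHom
    (MonoidHom.toAdditive (DMap.compLeft U.unop (DMap.evalHom A x) (DMap.dSmooth_evalHom x)))
  naturality _ _ _ := rfl

end SmoothFunctions

/-! ## Čech cohomology -/

/-- An open cover of `X`: a set of open subsets whose union is `X`. -/
structure OpenCover (X : Type u) [TopologicalSpace X] where
  /-- the members of the cover -/
  sets : Set (Opens X)
  /-- the members cover `X` -/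
  covers : ∀ x : X, ∃ U ∈ sets, x ∈ U

/-- Open covers are preordered by refinement: `𝒰 ≤ 𝒱` if `𝒱` refines `𝒰`. -/
instance (X : Type u) [TopologicalSpace X] : Preorder (OpenCover X) where
  le 𝒰 𝒱 := ∀ V ∈ 𝒱.sets, ∃ U ∈ 𝒰.sets, V ≤ U
  le_refl _ V hV := ⟨V, hV, le_rfl⟩
  le_trans _ _ _ h₁ h₂ W hW :=
    have ⟨V, hV, hWV⟩ := h₂ W hW
    have ⟨U, hU, hVU⟩ := h₁ V hV
    ⟨U, hU, hWV.trans hVU⟩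

namespace Cech

open CategoryTheory Opposite

variable {X : Type u} [TopologicalSpace X]

/-- The intersection `U_{i 0} ∩ … ∩ U_{i k}`. -/
def inter (𝒰 : OpenCover X) {k : ℕ} (i : Fin k → 𝒰.sets) : Opens X :=
  ⟨⋂ j, ((i j : Opens X) : Set X), isOpen_iInter_of_finite fun j => (i j : Opens X).isOpen⟩

theorem inter_le_comp (𝒰 : OpenCover X) {k l : ℕ} (i : Fin k → 𝒰.sets) (f : Fin l → Fin k) :
    inter 𝒰 i ≤ inter 𝒰 (i ∘ f) := fun _ hx =>
  Set.mem_iInter.2 fun j => Set.mem_iInter.1 hx (f j)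

theorem inter_le_refine {𝒰 𝒱 : OpenCover X} (r : 𝒱.sets → 𝒰.sets)
    (hr : ∀ V : 𝒱.sets, (V : Opens X) ≤ (r V : Opens X)) {k : ℕ} (i : Fin k → 𝒱.sets) :
    inter 𝒱 i ≤ inter 𝒰 (r ∘ i) := fun _ hx =>
  Set.mem_iInter.2 fun j => hr (i j) (Set.mem_iInter.1 hx j)

/-- The Čech `k`-cochains `∏_{i₀, …, i_k} F(U_{i₀} ∩ … ∩ U_{i_k})` of a cover. -/
abbrev Cochain (F : (Opens X)ᵒᵖ ⥤ AddCommGrpCat.{w}) (𝒰 : OpenCover X) (k : ℕ) : Type (max u w) :=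
  ∀ i : Fin (k + 1) → 𝒰.sets, F.obj (op (inter 𝒰 i))

/-- Restriction of sections of `F`. -/
abbrev res (F : (Opens X)ᵒᵖ ⥤ AddCommGrpCat.{w}) {U V : Opens X} (h : V ≤ U) :
    F.obj (op U) →+ F.obj (op V) := (F.map (homOfLE h).op).hom

theorem res_res (F : (Opens X)ᵒᵖ ⥤ AddCommGrpCat.{w}) {U V W : Opens X} (h : V ≤ U) (h' : W ≤ V)
    (s : F.obj (op U)) : res F h' (res F h s) = res F (h'.trans h) s := by
  have := F.map_comp (homOfLE h).op (homOfLE h').op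
  exact (congrArg (fun φ => φ.hom s) this).symm

/-- The Čech differential
`(d c)_{i₀ … i_{k+1}} = ∑ⱼ (-1)ʲ c_{i₀ … îⱼ … i_{k+1}}` (restricted to `U_{i₀ … i_{k+1}}`). -/
def d (F : (Opens X)ᵒᵖ ⥤ AddCommGrpCat.{w}) (𝒰 : OpenCover X) (k : ℕ) :
    Cochain F 𝒰 k →+ Cochain F 𝒰 (k + 1) where
  toFun c i := ∑ j : Fin (k + 2),
    (-1 : ℤ) ^ (j : ℕ) • res F (inter_le_comp 𝒰 i j.succAbove) (c (i ∘ j.succAbove))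
  map_zero' := by ext i; simp
  map_add' c c' := by ext i; simp [Finset.sum_add_distrib]

/-- The cocycles in degree `k`. -/
def cocycles (F : (Opens X)ᵒᵖ ⥤ AddCommGrpCat.{w}) (𝒰 : OpenCover X) (k : ℕ) :
    AddSubgroup (Cochain F 𝒰 k) := (d F 𝒰 k).ker

/-- The coboundaries in degree `k`. -/
def coboundaries (F : (Opens X)ᵒᵖ ⥤ AddCommGrpCat.{w}) (𝒰 : OpenCover X) :
    (k : ℕ) → AddSubgroup (Cochain F 𝒰 k)
  | 0 => ⊥
  | k + 1 => (d F 𝒰 k).range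

/-- The Čech cohomology `Ȟᵏ(𝒰; F)` of a cover: cocycles modulo coboundaries. -/
abbrev CoverCohomology (F : (Opens X)ᵒᵖ ⥤ AddCommGrpCat.{w}) (𝒰 : OpenCover X) (k : ℕ) :
    Type (max u w) :=
  cocycles F 𝒰 k ⧸ (coboundaries F 𝒰 k).addSubgroupOf (cocycles F 𝒰 k)

/-- The map induced on cohomology by a map of cochain complexes. -/
def coverMap {F G : (Opens X)ᵒᵖ ⥤ AddCommGrpCat.{w}} {𝒰 𝒱 : OpenCover X}
    (g : ∀ k, Cochain F 𝒰 k →+ Cochain G 𝒱 k)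
    (hg : ∀ k c, d G 𝒱 k (g k c) = g (k + 1) (d F 𝒰 k c)) (k : ℕ) :
    CoverCohomology F 𝒰 k →+ CoverCohomology G 𝒱 k :=
  QuotientAddGroup.map _ _
    (((g k).comp (cocycles F 𝒰 k).subtype).codRestrict (cocycles G 𝒱 k) fun c => by
      have hc : d F 𝒰 k c = 0 := c.2
      change d G 𝒱 k (g k c) = 0
      rw [hg, hc, map_zero])
    (by
      rintro ⟨c, hc⟩ hb
      rw [AddSubgroup.mem_addSubgroupOf] at hb
      rw [AddSubgroup.mem_comap, AddSubgroup.mem_addSubgroupOf]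
      change g k c ∈ coboundaries G 𝒱 k
      change c ∈ coboundaries F 𝒰 k at hb
      cases k with
      | zero =>
        have : c = 0 := hb
        rw [this, map_zero]
        exact zero_mem _
      | succ k =>
        obtain ⟨b, rfl⟩ := hb
        exact ⟨g k b, hg k b⟩)

/-- Pull-back of cochains along a refinement. -/
def refineCochain (F : (Opens X)ᵒᵖ ⥤ AddCommGrpCat.{w}) {𝒰 𝒱 : OpenCover X}
    (r : 𝒱.sets → 𝒰.sets) (hr : ∀ V : 𝒱.sets, (V : Opens X) ≤ (r V : Opens X)) (k : ℕ) :
    Cochain F 𝒰 k →+ Cochain F 𝒱 k where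
  toFun c i := res F (inter_le_refine r hr i) (c (r ∘ i))
  map_zero' := by ext i; simp
  map_add' c c' := by ext i; simp

theorem d_refineCochain (F : (Opens X)ᵒᵖ ⥤ AddCommGrpCat.{w}) {𝒰 𝒱 : OpenCover X}
    (r : 𝒱.sets → 𝒰.sets) (hr : ∀ V : 𝒱.sets, (V : Opens X) ≤ (r V : Opens X)) (k : ℕ)
    (c : Cochain F 𝒰 k) :
    d F 𝒱 k (refineCochain F r hr k c) = refineCochain F r hr (k + 1) (d F 𝒰 k c) := by
  ext i
  change ∑ j : Fin (k + 2), (-1 : ℤ) ^ (j : ℕ) • res F _ (res F _ _) =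
    res F _ (∑ j : Fin (k + 2), (-1 : ℤ) ^ (j : ℕ) • res F _ _)
  rw [map_sum]
  refine Finset.sum_congr rfl fun j _ => ?_
  rw [map_zsmul, res_res, res_res]
  rfl

/-- The map `Ȟᵏ(𝒰; F) → Ȟᵏ(𝒱; F)` for a refinement `𝒱` of `𝒰`, computed with some choice of a
member of `𝒰` containing `V` for every `V` in `𝒱` (on cohomology, it does not depend on that
choice). -/
noncomputable def refine (F : (Opens X)ᵒᵖ ⥤ AddCommGrpCat.{w}) (k : ℕ) (𝒰 𝒱 : OpenCover X)
    (h : 𝒰 ≤ 𝒱) : CoverCohomology F 𝒰 k →+ CoverCohomology F 𝒱 k :=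
  coverMap
    (refineCochain F (fun V : 𝒱.sets => ⟨(h V.1 V.2).choose, (h V.1 V.2).choose_spec.1⟩)
      fun V => (h V.1 V.2).choose_spec.2)
    (d_refineCochain F _ _) k

open Classical in
/-- The Čech cohomology `Ȟᵏ(X; F)`: the direct limit of `Ȟᵏ(𝒰; F)` over all open covers of `X`,
ordered by refinement. -/
abbrev Cohomology (F : (Opens X)ᵒᵖ ⥤ AddCommGrpCat.{w}) (k : ℕ) : Type (max u w) :=
  AddCommGroup.DirectLimit (fun 𝒰 : OpenCover X => CoverCohomology F 𝒰 k) (refine F k)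

/-- The map on cochains induced by a morphism of coefficients. -/
def coeffCochain {F G : (Opens X)ᵒᵖ ⥤ AddCommGrpCat.{w}} (φ : F ⟶ G) (𝒰 : OpenCover X) (k : ℕ) :
    Cochain F 𝒰 k →+ Cochain G 𝒰 k where
  toFun c i := (φ.app _).hom (c i)
  map_zero' := by ext i; simp
  map_add' c c' := by ext i; simp

theorem app_res {F G : (Opens X)ᵒᵖ ⥤ AddCommGrpCat.{w}} (φ : F ⟶ G) {U V : Opens X} (h : V ≤ U)
    (s : F.obj (op U)) : (φ.app (op V)).hom (res F h s) = res G h ((φ.app (op U)).hom s) :=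
  congrArg (fun ψ => ψ.hom s) (φ.naturality (homOfLE h).op)

theorem d_coeffCochain {F G : (Opens X)ᵒᵖ ⥤ AddCommGrpCat.{w}} (φ : F ⟶ G) (𝒰 : OpenCover X)
    (k : ℕ) (c : Cochain F 𝒰 k) :
    d G 𝒰 k (coeffCochain φ 𝒰 k c) = coeffCochain φ 𝒰 (k + 1) (d F 𝒰 k c) := by
  ext i
  change ∑ j : Fin (k + 2), (-1 : ℤ) ^ (j : ℕ) • res G _ ((φ.app _).hom _) =
    (φ.app _).hom (∑ j : Fin (k + 2), (-1 : ℤ) ^ (j : ℕ) • res F _ _)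
  rw [map_sum]
  refine Finset.sum_congr rfl fun j _ => ?_
  rw [map_zsmul, app_res]

/-- The map on the cohomology of a cover induced by a morphism of coefficients. -/
def coverCoeffMap {F G : (Opens X)ᵒᵖ ⥤ AddCommGrpCat.{w}} (φ : F ⟶ G) (k : ℕ) (𝒰 : OpenCover X) :
    CoverCohomology F 𝒰 k →+ CoverCohomology G 𝒰 k :=
  coverMap (coeffCochain φ 𝒰) (d_coeffCochain φ 𝒰) k

theorem coverCoeffMap_refine {F G : (Opens X)ᵒᵖ ⥤ AddCommGrpCat.{w}} (φ : F ⟶ G) (k : ℕ)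
    (𝒰 𝒱 : OpenCover X) (h : 𝒰 ≤ 𝒱) :
    (coverCoeffMap φ k 𝒱).comp (refine F k 𝒰 𝒱 h) =
      (refine G k 𝒰 𝒱 h).comp (coverCoeffMap φ k 𝒰) := by
  ext ⟨c, hc⟩
  refine congrArg (fun z : cocycles G 𝒱 k => (z : CoverCohomology G 𝒱 k)) (Subtype.ext ?_)
  funext i
  exact app_res φ _ _

open Classical in
/-- The map `Ȟᵏ(X; F) → Ȟᵏ(X; G)` induced by a morphism of coefficients `F → G`. -/
noncomputable def map {F G : (Opens X)ᵒᵖ ⥤ AddCommGrpCat.{w}} (φ : F ⟶ G) (k : ℕ) :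
    Cohomology F k →+ Cohomology G k :=
  AddCommGroup.DirectLimit.map (coverCoeffMap φ k) (coverCoeffMap_refine φ k)

end Cech

/-! ## The objects of the theorem -/

/-- A space is `n`-connected if it is (nonempty and) path connected and its homotopy groups `π_k`
vanish for `1 ≤ k ≤ n`, at every base point. -/
def IsNConnected (n : ℕ) (M : Type*) [TopologicalSpace M] : Prop :=
  PathConnectedSpace M ∧ ∀ k, 1 ≤ k → k ≤ n → ∀ y : M, Subsingleton (HomotopyGroup.Pi k M y)

/-!
Constant maps `U(1) → U(1)ᴹ` form a section of the evaluation `ev_x`, so the map on Čech cohomology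
is surjective, already for every single cover (`coverCoeffMap_eval_surjective`).

For injectivity, the point is that the kernel of `ev_x` is a module over the smooth functions on `X`.
As `M` is simply connected, every `f : M → U(1)` has a unique continuous `ℓ f : M → ℝ` with
`exp (√-1 ℓ f) = f / f x` and `ℓ f x = 0` (`angle`). By uniqueness `ℓ` is a homomorphism
(`angle_mul`). It is smooth in the sense of diffeology (`contDiff_angle`): along a plot
`ℝᵏ → U(1)ᴹ` the logarithms fit together to a lift on the simply connected space `ℝᵏ × M`, which is
continuous, and a continuous logarithm of a smooth function is smooth.

Let `ρ` be a partition of unity subordinate to a cover, and `c` a cocycle of positive degree with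
values in `U(1)ᴹ`. The cochain `b_i = exp (√-1 ∑ U, ρ_U · ℓ (c_{U, i}))` (`contractCochain`) has
coboundary `c / c(x)` (`d_contractCochain`). If `ev_x c` is a coboundary then so is the constant part
`c(x)`, and hence so is `c` (`coverCoeffMap_eval_injective`). The map is therefore bijective for
every cover, and so it is in the direct limit.
-/

/-! ### Logarithms of circle-valued maps on a simply connected manifold -/

theorem simplyConnectedSpace_of_subsingleton_pi_one {M : Type*} [TopologicalSpace M]
    [PathConnectedSpace M] (h : ∀ y : M, Subsingleton (HomotopyGroup.Pi 1 M y)) :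
    SimplyConnectedSpace M := by
  refine simply_connected_iff_loops_nullhomotopic.2 ⟨inferInstance, fun y γ => ?_⟩
  have := h y
  have : Subsingleton (FundamentalGroup M y) :=
    (HomotopyGroup.pi1EquivFundamentalGroup (X := M) (x := y)).symm.subsingleton
  exact Path.Homotopic.Quotient.eq.1
    (Subsingleton.elim (α := FundamentalGroup M y) (.mk γ) (.mk (Path.refl y)))

theorem SimplyConnectedSpace.prod_of_contractible {E M : Type*} [TopologicalSpace E]
    [ContractibleSpace E] [TopologicalSpace M] [SimplyConnectedSpace M] :
    SimplyConnectedSpace (E × M) := by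
  obtain ⟨e⟩ := ContractibleSpace.hequiv_unit E
  exact ((e.prodCongr (.refl M)).trans
    (Homeomorph.punitProd M).toHomotopyEquiv).simplyConnectedSpace

/-- A continuous real logarithm of a smooth circle-valued function is smooth. -/
theorem contDiff_of_contMDiff_circleExp {E : Type*} [NormedAddCommGroup E] [NormedSpace ℝ E]
    {φ : E → ℝ} (hφ : Continuous φ)
    (h : ContMDiff 𝓘(ℝ, E) (𝓡 1) ∞ fun t => Circle.exp (φ t)) : ContDiff ℝ ∞ φ := by
  rw [contDiff_iff_contDiffAt]
  intro t₀
  have := finrank_real_complex_fact'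
  have hcoe : ContMDiff (𝓡 1) 𝓘(ℝ, ℂ) ∞ (fun z : Circle => (z : ℂ)) := contMDiff_coe_sphere
  have h1 : ContDiff ℝ ∞ fun t => ((Circle.exp (φ t) : Circle) : ℂ) := (hcoe.comp h).contDiff
  have h2 : ContDiffAt ℝ ∞ (fun t => φ t₀ + (Complex.log
      ((Circle.exp (φ t) : ℂ) * (Circle.exp (-φ t₀) : ℂ))).im) t₀ := by
    have h3 : ContDiffAt ℝ ∞ (fun t => (Circle.exp (φ t) : ℂ) * (Circle.exp (-φ t₀) : ℂ)) t₀ :=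
      (h1.mul contDiff_const).contDiffAt
    have h4 : (Circle.exp (φ t₀) : ℂ) * (Circle.exp (-φ t₀) : ℂ) ∈ Complex.slitPlane := by
      rw [← Circle.coe_mul, ← Circle.exp_add]; simp
    have h5 := ((Complex.contDiffAt_log h4 (n := ∞)).restrict_scalars ℝ).comp t₀ h3
    exact contDiffAt_const.add (Complex.imCLM.contDiff.contDiffAt.comp t₀ h5)
  -- near `t₀` the principal branch computes `φ t - φ t₀`, as that is less than `π` in size
  refine h2.congr_of_eventuallyEq ?_
  have : ∀ᶠ t in 𝓝 t₀, φ t - φ t₀ ∈ Set.Ioo (-Real.pi) Real.pi :=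
    (hφ.sub continuous_const).continuousAt.eventually_mem
      (isOpen_Ioo.mem_nhds (by simp [Real.pi_pos]))
  filter_upwards [this] with t ht
  rw [← Circle.coe_mul, ← Circle.exp_add, ← sub_eq_add_neg, Complex.log_im,
    Circle.arg_exp ht.1 ht.2.le]
  ring

/-- Two continuous real logarithms of the same circle-valued function on a connected space agree if
they agree at one point. -/
theorem continuous_lift_unique {A : Type*} [TopologicalSpace A] [PreconnectedSpace A]
    {F G : A → ℝ} (hF : Continuous F) (hG : Continuous G)
    (h : ∀ a, Circle.exp (F a) = Circle.exp (G a)) (a : A) (ha : F a = G a) : F = G :=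
  Circle.isCoveringMap_exp.eq_of_comp_eq hF hG (funext h) a ha

section Angle

variable {m : ℕ} {M : Type*} [TopologicalSpace M] [ChartedSpace (EuclideanSpace ℝ (Fin m)) M]
  [DiffeologicalSpace M]

/-- Smooth maps on `ℝᵏ × M` in the sense of diffeology are continuous, since a chart of `M` gives a
plot that parametrises a neighbourhood of any given point. -/
theorem continuous_of_dSmooth_prod [IsManifold (𝓡 m) ∞ M]
    (hM : ∀ {k : ℕ} {p : EuclideanSpace ℝ (Fin k) → M}, IsPlot p ↔ ContMDiff (𝓡 k) (𝓡 m) ∞ p)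
    {k : ℕ} {g : EuclideanSpace ℝ (Fin k) × M → Circle} (hg : DSmooth g) : Continuous g := by
  rw [continuous_iff_continuousAt]
  rintro ⟨t₀, y₀⟩
  set e := chartAt (EuclideanSpace ℝ (Fin m)) y₀ with he
  obtain ⟨r, hr, hball⟩ := Metric.isOpen_iff.mp e.open_target (e y₀) (mem_chart_target _ y₀)
  set v := OpenPartialHomeomorph.univBall (e y₀) r with hv
  have hvt : v.target = Metric.ball (e y₀) r := OpenPartialHomeomorph.univBall_target _ hr
  have hvs : v.source = Set.univ := OpenPartialHomeomorph.univBall_source _ _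
  have hp : ContMDiff (𝓡 m) (𝓡 m) ∞ (fun s => e.symm (v s)) := by
    refine (contMDiffOn_chart_symm (I := 𝓡 m) (x := y₀)).comp_contMDiff
      OpenPartialHomeomorph.contDiff_univBall.contMDiff fun s => hball ?_
    rw [← hvt]
    exact v.map_source (by simp [hvs])
  let L := EuclideanSpace.finAddEquivProd (𝕜 := ℝ) (n := k) (m := m)
  have hq : IsPlot (fun s : EuclideanSpace ℝ (Fin (k + m)) => ((L s).1, e.symm (v (L s).2))) :=
    ⟨(contDiff_fst.comp L.contDiff).isPlot,
      hM.2 (hp.comp (contDiff_snd.comp L.contDiff).contMDiff)⟩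
  have hc : Continuous (g ∘ fun s : EuclideanSpace ℝ (Fin (k + m)) =>
      ((L s).1, e.symm (v (L s).2))) :=
    ContMDiff.continuous (I := 𝓡 (k + m)) (I' := 𝓡 1) (hg _ _ hq)
  have hback : ContinuousAt (fun z : EuclideanSpace ℝ (Fin k) × M =>
      L.symm (z.1, v.symm (e z.2))) (t₀, y₀) := by
    refine L.symm.continuous.continuousAt.comp (continuousAt_fst.prodMk ?_)
    have h1 : ContinuousAt v.symm (e y₀) :=
      v.continuousAt_symm (by rw [hvt]; exact Metric.mem_ball_self hr)
    have h2 : ContinuousAt e y₀ := e.continuousAt (mem_chart_source _ y₀)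
    exact ContinuousAt.comp (f := fun z : EuclideanSpace ℝ (Fin k) × M => e z.2)
      h1 (ContinuousAt.comp (g := e) h2 continuousAt_snd)
  refine (hc.continuousAt.comp hback).congr ?_
  have hev : ∀ᶠ y in 𝓝 y₀, y ∈ e.source ∧ e y ∈ v.target := by
    refine Filter.Eventually.and (e.open_source.mem_nhds (mem_chart_source _ y₀))
      ((e.continuousAt (mem_chart_source _ y₀)).eventually_mem (v.open_target.mem_nhds ?_))
    rw [hvt]; exact Metric.mem_ball_self hr
  filter_upwards [continuousAt_snd.eventually hev] with z hz
  simp [v.right_inv hz.2, e.left_inv hz.1]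

/-- The unique continuous `ℓ : M → ℝ` with `exp (i ℓ) = f / f x` and `ℓ x = 0`, for a smooth
`f : M → U(1)` on a simply connected manifold (and the zero function where there is none). -/
noncomputable def angle (x : M) (f : DMap M Circle) : M → ℝ :=
  open Classical in
  if h : ∃ F : C(M, ℝ), F x = 0 ∧ ∀ y, Circle.exp (F y) = f.toFun y / f.toFun x then h.choose
  else 0

variable [IsManifold (𝓡 m) ∞ M] [SimplyConnectedSpace M]

/-- Along a plot `P` of `U(1)ᴹ`, the logarithms of `P t / P t x` that vanish at `x` can be chosen
jointly continuous: `ℝᵏ × M` is simply connected, so the lift exists there at once. -/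
theorem exists_continuous_lift (x : M)
    (hM : ∀ {k : ℕ} {p : EuclideanSpace ℝ (Fin k) → M}, IsPlot p ↔ ContMDiff (𝓡 k) (𝓡 m) ∞ p)
    {k : ℕ} {P : EuclideanSpace ℝ (Fin k) → DMap M Circle} (hP : IsPlot P) :
    ∃ F : EuclideanSpace ℝ (Fin k) × M → ℝ, Continuous F ∧ (∀ t, F (t, x) = 0) ∧
      ∀ z, Circle.exp (F z) = (P z.1).toFun z.2 / (P z.1).toFun x := by
  have : LocallyPathConnectedSpace M :=
    ChartedSpace.locallyPathConnectedSpace (EuclideanSpace ℝ (Fin m)) M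
  have : SimplyConnectedSpace (EuclideanSpace ℝ (Fin k) × M) :=
    SimplyConnectedSpace.prod_of_contractible
  have hg : Continuous fun z : EuclideanSpace ℝ (Fin k) × M => (P z.1).toFun z.2 :=
    continuous_of_dSmooth_prod hM hP
  have hg' : Continuous fun z : EuclideanSpace ℝ (Fin k) × M =>
      (P z.1).toFun z.2 / (P z.1).toFun x :=
    hg.div' (hg.comp (continuous_fst.prodMk continuous_const))
  obtain ⟨F, ⟨hF0, hF⟩, -⟩ := Circle.isCoveringMap_exp.existsUnique_continuousMap_lifts
    ⟨_, hg'⟩ ((0 : EuclideanSpace ℝ (Fin k)), x) 0 (by simp)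
  refine ⟨F, F.continuous, fun t => ?_, fun z => congrFun hF z⟩
  -- on `ℝᵏ × {x}` the function to be lifted is constantly `1`, so the lift stays at `0`
  refine congrFun (continuous_lift_unique (F := fun t => F (t, x)) (G := fun _ => 0)
    (F.continuous.comp (continuous_id.prodMk continuous_const)) continuous_const
    (fun t => ?_) 0 hF0) t
  simpa using congrFun hF (t, x)

theorem angle_spec (x : M)
    (hM : ∀ {k : ℕ} {p : EuclideanSpace ℝ (Fin k) → M}, IsPlot p ↔ ContMDiff (𝓡 k) (𝓡 m) ∞ p)
    (f : DMap M Circle) : Continuous (angle x f) ∧ angle x f x = 0 ∧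
      ∀ y, Circle.exp (angle x f y) = f.toFun y / f.toFun x := by
  obtain ⟨F, hF, hF0, hFe⟩ := exists_continuous_lift x hM (k := 0) (P := fun _ => f) isPlot_const
  have h : ∃ F : C(M, ℝ), F x = 0 ∧ ∀ y, Circle.exp (F y) = f.toFun y / f.toFun x :=
    ⟨⟨fun y => F (0, y), by fun_prop⟩, hF0 0, fun y => hFe (0, y)⟩
  rw [angle, dif_pos h]
  exact ⟨h.choose.continuous, h.choose_spec⟩

theorem angle_mul (x : M)
    (hM : ∀ {k : ℕ} {p : EuclideanSpace ℝ (Fin k) → M}, IsPlot p ↔ ContMDiff (𝓡 k) (𝓡 m) ∞ p)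
    (f g : DMap M Circle) : angle x (f * g) = angle x f + angle x g := by
  obtain ⟨cf, f0, fe⟩ := angle_spec x hM f
  obtain ⟨cg, g0, ge⟩ := angle_spec x hM g
  obtain ⟨c, h0, he⟩ := angle_spec x hM (f * g)
  refine continuous_lift_unique c (cf.add cg) (fun y => ?_) x (by simp [f0, g0, h0])
  rw [he, Pi.add_apply, Circle.exp_add, fe, ge, div_mul_div_comm]
  rfl

/-- The lift `angle x f y` depends smoothly on `f` and `y` jointly. -/
theorem contDiff_angle (x : M)
    (hM : ∀ {k : ℕ} {p : EuclideanSpace ℝ (Fin k) → M}, IsPlot p ↔ ContMDiff (𝓡 k) (𝓡 m) ∞ p)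
    {k : ℕ} {P : EuclideanSpace ℝ (Fin k) → DMap M Circle} (hP : IsPlot P)
    {q : EuclideanSpace ℝ (Fin k) → M} (hq : IsPlot q) :
    ContDiff ℝ ∞ fun t => angle x (P t) (q t) := by
  obtain ⟨F, hF, hF0, hFe⟩ := exists_continuous_lift x hM hP
  have hFa : ∀ t y, F (t, y) = angle x (P t) y := fun t => by
    obtain ⟨c, h0, he⟩ := angle_spec x hM (P t)
    refine congrFun (continuous_lift_unique (F := fun y => F (t, y)) (by fun_prop) c
      (fun y => ?_) x ((hF0 t).trans h0.symm))
    rw [hFe, he]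
  have hqc : Continuous q := (hM.1 hq).continuous
  refine contDiff_of_contMDiff_circleExp ?_ ?_
  · simp_rw [← hFa]
    fun_prop
  · simp_rw [(angle_spec x hM (P _)).2.2]
    have h1 : ContMDiff (𝓡 k) (𝓡 1) ∞ fun t => (P t).toFun (q t) :=
      hP k (fun t => (t, q t)) ⟨isPlot_id, hq⟩
    have h2 : ContMDiff (𝓡 k) (𝓡 1) ∞ fun t => (P t).toFun x :=
      hP k (fun t => (t, x)) ⟨isPlot_id, isPlot_const⟩
    exact h1.div h2

end Angle

/-! ### Contraction of cochains with a partition of unity -/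

section Cochains

open CategoryTheory Opposite

theorem mem_inter_cons {X : Type u} [TopologicalSpace X] {𝒰 : OpenCover X} {k : ℕ}
    {U : 𝒰.sets} {i : Fin k → 𝒰.sets} {u : X} :
    u ∈ Cech.inter 𝒰 (Fin.cons U i : Fin (k + 1) → 𝒰.sets) ↔
      u ∈ (U : Opens X) ∧ u ∈ Cech.inter 𝒰 i := by
  change u ∈ ⋂ j, _ ↔ _ ∧ u ∈ ⋂ j, _
  simp [Set.mem_iInter, Fin.forall_fin_succ]

variable {X : Type u} [TopologicalSpace X] [DiffeologicalSpace X]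

/-- The map `A → Aᴹ` sending `a` to the constant map with value `a`. -/
def DMap.constHom (M A : Type*) [DiffeologicalSpace M] [CommGroup A] [DiffeologicalSpace A]
    [IsDiffeologicalGroup A] : A →* DMap M A where
  toFun a := ⟨fun _ => a, dSmooth_const⟩
  map_one' := rfl
  map_mul' _ _ := rfl

theorem DMap.dSmooth_constHom (M A : Type*) [DiffeologicalSpace M] [CommGroup A]
    [DiffeologicalSpace A] [IsDiffeologicalGroup A] : DSmooth (DMap.constHom M A) :=
  fun _ _ hp _ _ hq => isPlot_reparam hp (IsPlot.contDiff hq.1)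

/-- Smooth `A`-valued functions as smooth `Aᴹ`-valued functions with constant values: a section of
`evalSmoothFunctions`. -/
def constSmoothFunctions (X M : Type u) [TopologicalSpace X] [DiffeologicalSpace X]
    [DiffeologicalSpace M] (A : Type) [CommGroup A] [DiffeologicalSpace A]
    [IsDiffeologicalGroup A] :
    smoothFunctions X A ⟶ smoothFunctions X (DMap M A) where
  app U := AddCommGrpCat.ofHom
    (MonoidHom.toAdditive (DMap.compLeft U.unop (DMap.constHom M A) (DMap.dSmooth_constHom M A)))
  naturality _ _ _ := rfl

/-- The value of a section of `smoothFunctions X A` at a point. -/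
def sectionEval {A : Type v} [CommGroup A] [DiffeologicalSpace A] [IsDiffeologicalGroup A]
    {U : Opens X} (u : X) (hu : u ∈ U) : (smoothFunctions X A).obj (op U) →+ Additive A :=
  (MonoidHom.toAdditive (DMap.evalHom A ⟨u, hu⟩) : Additive (DMap U A) →+ Additive A)

theorem sectionEval_res {A : Type v} [CommGroup A] [DiffeologicalSpace A]
    [IsDiffeologicalGroup A] {U V : Opens X} (h : V ≤ U) {u : X} (hu : u ∈ V)
    (s : (smoothFunctions X A).obj (op U)) :
    sectionEval u hu (Cech.res (smoothFunctions X A) h s) = sectionEval u (h hu) s := rfl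

theorem sectionEval_ext {A : Type v} [CommGroup A] [DiffeologicalSpace A]
    [IsDiffeologicalGroup A] {U : Opens X} {s t : (smoothFunctions X A).obj (op U)}
    (h : ∀ u (hu : u ∈ U), sectionEval u hu s = sectionEval u hu t) : s = t :=
  DMap.ext (funext fun u => h u u.2)

theorem sectionEval_d {A : Type v} [CommGroup A] [DiffeologicalSpace A]
    [IsDiffeologicalGroup A] {𝒰 : OpenCover X} {k : ℕ}
    (c : Cech.Cochain (smoothFunctions X A) 𝒰 k) (i : Fin (k + 2) → 𝒰.sets)
    {u : X} (hu : u ∈ Cech.inter 𝒰 i) :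
    sectionEval u hu (Cech.d (smoothFunctions X A) 𝒰 k c i) =
      ∑ j : Fin (k + 2), (-1 : ℤ) ^ (j : ℕ) •
        sectionEval u (Cech.inter_le_comp 𝒰 i j.succAbove hu) (c (i ∘ j.succAbove)) := by
  change sectionEval u hu (∑ j : Fin (k + 2), (-1 : ℤ) ^ (j : ℕ) •
    Cech.res (smoothFunctions X A) (Cech.inter_le_comp 𝒰 i j.succAbove) (c (i ∘ j.succAbove))) = _
  rw [map_sum]
  exact Finset.sum_congr rfl fun j _ => by rw [map_zsmul, sectionEval_res]

variable {M : Type u} [DiffeologicalSpace M]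

open Classical in
/-- The values `ℓ (c_i(u))(y)` of the logarithms of a cochain, extended by zero outside the
intersection `U_{i 0} ∩ … ∩ U_{i k}` on which `c_i` is defined. -/
noncomputable def logCochain (ℓ : Additive (DMap M Circle) →+ (M → ℝ)) {𝒰 : OpenCover X} {k : ℕ}
    (c : Cech.Cochain (smoothFunctions X (DMap M Circle)) 𝒰 k) (i : Fin (k + 1) → 𝒰.sets)
    (u : X) (y : M) : ℝ :=
  if h : u ∈ Cech.inter 𝒰 i then ℓ (sectionEval u h (c i)) y else 0

theorem logCochain_of_mem (ℓ : Additive (DMap M Circle) →+ (M → ℝ)) {𝒰 : OpenCover X} {k : ℕ}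
    (c : Cech.Cochain (smoothFunctions X (DMap M Circle)) 𝒰 k) {i : Fin (k + 1) → 𝒰.sets}
    {u : X} (h : u ∈ Cech.inter 𝒰 i) (y : M) :
    logCochain ℓ c i u y = ℓ (sectionEval u h (c i)) y := by
  rw [logCochain, dif_pos h]

theorem sum_logCochain_eq (ℓ : Additive (DMap M Circle) →+ (M → ℝ)) {𝒰 : OpenCover X} {k : ℕ}
    {c : Cech.Cochain (smoothFunctions X (DMap M Circle)) 𝒰 k}
    (i : Fin (k + 2) → 𝒰.sets) {u : X} (hu : u ∈ Cech.inter 𝒰 i) (y : M) :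
    ∑ j : Fin (k + 2), (-1 : ℝ) ^ (j : ℕ) * logCochain ℓ c (i ∘ j.succAbove) u y =
      logCochain ℓ (Cech.d (smoothFunctions X (DMap M Circle)) 𝒰 k c) i u y := by
  rw [logCochain_of_mem ℓ _ hu, sectionEval_d, map_sum, Finset.sum_apply]
  refine Finset.sum_congr rfl fun j _ => ?_
  rw [logCochain_of_mem ℓ c (Cech.inter_le_comp 𝒰 i j.succAbove hu), map_zsmul, Pi.smul_apply,
    zsmul_eq_mul]
  push_cast
  rfl

/-- On a cocycle, contracting the index `U` undoes the alternating sum over faces. -/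
theorem sum_logCochain_cons (ℓ : Additive (DMap M Circle) →+ (M → ℝ)) {𝒰 : OpenCover X} {k : ℕ}
    {c : Cech.Cochain (smoothFunctions X (DMap M Circle)) 𝒰 (k + 1)}
    (hc : Cech.d (smoothFunctions X (DMap M Circle)) 𝒰 (k + 1) c = 0)
    {U : 𝒰.sets} (i : Fin (k + 2) → 𝒰.sets) {u : X} (hU : u ∈ (U : Opens X))
    (hu : u ∈ Cech.inter 𝒰 i) (y : M) :
    ∑ j : Fin (k + 2), (-1 : ℝ) ^ (j : ℕ) *
      logCochain ℓ c (Fin.cons U (i ∘ j.succAbove)) u y = logCochain ℓ c i u y := by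
  have h := sum_logCochain_eq ℓ (c := c) (Fin.cons U i) (mem_inter_cons.2 ⟨hU, hu⟩) y
  rw [Fin.sum_univ_succ, hc, logCochain_of_mem ℓ _ (mem_inter_cons.2 ⟨hU, hu⟩), Pi.zero_apply,
    map_zero, map_zero, Pi.zero_apply] at h
  have h0 : (Fin.cons U i : Fin (k + 3) → 𝒰.sets) ∘ (0 : Fin (k + 3)).succAbove = i := by
    ext j; simp
  simp_rw [Fin.cons_comp_succ_succAbove, h0] at h
  simp only [Fin.val_zero, pow_zero, one_mul, Fin.val_succ, pow_succ, mul_neg, mul_one, neg_mul,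
    Finset.sum_neg_distrib] at h
  exact (eq_of_sub_eq_zero (by rw [sub_eq_add_neg]; exact h)).symm

variable {n : ℕ} [ChartedSpace (EuclideanSpace ℝ (Fin n)) X]

/-- The averages `∑ U, ρ_U · ℓ (c_{U, i})` are smooth on `U_{i 0} ∩ … ∩ U_{i k}`: each summand
extends by zero from `U`, which contains the support of `ρ_U`. -/
theorem contDiff_finsum_logCochain
    (hX : ∀ {k : ℕ} {p : EuclideanSpace ℝ (Fin k) → X}, IsPlot p ↔ ContMDiff (𝓡 k) (𝓡 n) ∞ p)
    (ℓ : Additive (DMap M Circle) →+ (M → ℝ))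
    (hℓ : ∀ {k : ℕ} {P : EuclideanSpace ℝ (Fin k) → DMap M Circle}, IsPlot P →
      ∀ {q : EuclideanSpace ℝ (Fin k) → M}, IsPlot q →
        ContDiff ℝ ∞ fun t => ℓ (Additive.ofMul (P t)) (q t))
    {𝒰 : OpenCover X} (ρ : SmoothPartitionOfUnity 𝒰.sets (𝓡 n) X)
    (hρ : ρ.IsSubordinate fun U => ((U : Opens X) : Set X)) {k : ℕ}
    (c : Cech.Cochain (smoothFunctions X (DMap M Circle)) 𝒰 (k + 1)) (i : Fin (k + 1) → 𝒰.sets)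
    {l : ℕ} {p : EuclideanSpace ℝ (Fin l) → X} (hp : IsPlot p) (hpi : ∀ t, p t ∈ Cech.inter 𝒰 i)
    {q : EuclideanSpace ℝ (Fin l) → M} (hq : IsPlot q) :
    ContDiff ℝ ∞ fun t => ∑ᶠ U, ρ U (p t) * logCochain ℓ c (Fin.cons U i) (p t) (q t) := by
  have hterm : ∀ U, ContDiff ℝ ∞
      fun t => ρ U (p t) * logCochain ℓ c (Fin.cons U i) (p t) (q t) := fun U => by
    refine IsPlot.contDiff (DiffeologicalSpace.locality fun t => ?_)
    have hpc : Continuous p := (hX.1 hp).continuous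
    by_cases ht : p t ∈ (U : Opens X)
    · refine ⟨p ⁻¹' (U : Opens X), (U : Opens X).isOpen.preimage hpc, ht, fun {r f} hf hfs => ?_⟩
      have hmem : ∀ s, p (f s) ∈ Cech.inter 𝒰 (Fin.cons U i : Fin (k + 2) → 𝒰.sets) :=
        fun s => mem_inter_cons.2 ⟨hf s, hpi _⟩
      have hpf : IsPlot (p ∘ f) := isPlot_reparam hp hfs
      have h1 : ContDiff ℝ ∞ fun s => ρ U (p (f s)) :=
        ((ρ U).contMDiff.comp (hX.1 hpf)).contDiff
      have h2 := hℓ ((c (Fin.cons U i)).smooth r (fun s => ⟨p (f s), hmem s⟩) hpf)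
        (isPlot_reparam hq hfs)
      have h3 : (fun t => ρ U (p t) * logCochain ℓ c (Fin.cons U i) (p t) (q t)) ∘ f =
          fun s => ρ U (p (f s)) * ℓ (Additive.ofMul ((c (Fin.cons U i)).toFun
            ⟨p (f s), hmem s⟩)) (q (f s)) :=
        funext fun s => congrArg _ (logCochain_of_mem ℓ c (hmem s) _)
      exact h3 ▸ (h1.mul h2).isPlot
    · refine ⟨p ⁻¹' (tsupport (ρ U))ᶜ, (isClosed_tsupport _).isOpen_compl.preimage hpc,
        fun h => ht (hρ U h), fun {r f} hf hfs => ?_⟩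
      have h3 : (fun t => ρ U (p t) * logCochain ℓ c (Fin.cons U i) (p t) (q t)) ∘ f =
          fun _ => 0 :=
        funext fun s => mul_eq_zero_of_left (image_eq_zero_of_notMem_tsupport (hf s)) _
      exact h3 ▸ isPlot_const
  refine ContMDiff.contDiff (contMDiff_finsum (fun U => (hterm U).contMDiff) ?_)
  exact (ρ.locallyFinite.preimage_continuous (hX.1 hp).continuous).subset
    fun U => Function.support_mul_subset_left _ _

/-- The cochain `b_i = exp (√-1 ∑ U, ρ_U · ℓ (c_{U, i}))`, obtained by contracting `c` with a
partition of unity. -/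
noncomputable def contractCochain
    (hX : ∀ {k : ℕ} {p : EuclideanSpace ℝ (Fin k) → X}, IsPlot p ↔ ContMDiff (𝓡 k) (𝓡 n) ∞ p)
    (ℓ : Additive (DMap M Circle) →+ (M → ℝ))
    (hℓ : ∀ {k : ℕ} {P : EuclideanSpace ℝ (Fin k) → DMap M Circle}, IsPlot P →
      ∀ {q : EuclideanSpace ℝ (Fin k) → M}, IsPlot q →
        ContDiff ℝ ∞ fun t => ℓ (Additive.ofMul (P t)) (q t))
    {𝒰 : OpenCover X} (ρ : SmoothPartitionOfUnity 𝒰.sets (𝓡 n) X)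
    (hρ : ρ.IsSubordinate fun U => ((U : Opens X) : Set X)) {k : ℕ}
    (c : Cech.Cochain (smoothFunctions X (DMap M Circle)) 𝒰 (k + 1)) :
    Cech.Cochain (smoothFunctions X (DMap M Circle)) 𝒰 k := fun i =>
  Additive.ofMul (α := DMap (Cech.inter 𝒰 i) (DMap M Circle))
    { toFun u :=
        { toFun y := Circle.exp (∑ᶠ U, ρ U u * logCochain ℓ c (Fin.cons U i) u y)
          smooth _ _ hq := contMDiff_circleExp.comp (contDiff_finsum_logCochain hX ℓ hℓ ρ hρ c i
            (p := fun _ => (u : X)) isPlot_const (fun _ => u.2) hq).contMDiff }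
      smooth _ P hP _ _ hq := contMDiff_circleExp.comp (contDiff_finsum_logCochain hX ℓ hℓ ρ hρ c i
        (isPlot_reparam hP (IsPlot.contDiff hq.1)) (fun _ => (P _).2) hq.2).contMDiff }

/-- If `c` is a cocycle, the coboundary of its contraction is `exp (√-1 ℓ(c))`: up to the logarithm,
contraction with a partition of unity is the usual homotopy on Čech cochains of a module over the
smooth functions. -/
theorem d_contractCochain
    (hX : ∀ {k : ℕ} {p : EuclideanSpace ℝ (Fin k) → X}, IsPlot p ↔ ContMDiff (𝓡 k) (𝓡 n) ∞ p)
    (ℓ : Additive (DMap M Circle) →+ (M → ℝ))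
    (hℓ : ∀ {k : ℕ} {P : EuclideanSpace ℝ (Fin k) → DMap M Circle}, IsPlot P →
      ∀ {q : EuclideanSpace ℝ (Fin k) → M}, IsPlot q →
        ContDiff ℝ ∞ fun t => ℓ (Additive.ofMul (P t)) (q t))
    {𝒰 : OpenCover X} (ρ : SmoothPartitionOfUnity 𝒰.sets (𝓡 n) X)
    (hρ : ρ.IsSubordinate fun U => ((U : Opens X) : Set X)) {k : ℕ}
    {c : Cech.Cochain (smoothFunctions X (DMap M Circle)) 𝒰 (k + 1)}
    (hc : Cech.d (smoothFunctions X (DMap M Circle)) 𝒰 (k + 1) c = 0)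
    (i : Fin (k + 2) → 𝒰.sets) {u : X} (hu : u ∈ Cech.inter 𝒰 i) (y : M) :
    (sectionEval u hu (Cech.d _ 𝒰 k (contractCochain hX ℓ hℓ ρ hρ c) i)).toMul.toFun y =
      Circle.exp (ℓ (sectionEval u hu (c i)) y) := by
  have hfin : ∀ i' : Fin (k + 1) → 𝒰.sets,
      ∑ᶠ U, ρ U u * logCochain ℓ c (Fin.cons U i') u y =
        ∑ U ∈ ρ.finsupport u, ρ U u * logCochain ℓ c (Fin.cons U i') u y := fun i' =>
    finsum_eq_sum_of_support_subset _ (by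
      rw [ρ.coe_finsupport]; exact Function.support_mul_subset_left _ _)
  have hsum : ∑ j : Fin (k + 2), (-1 : ℤ) ^ (j : ℕ) •
      ∑ᶠ U, ρ U u * logCochain ℓ c (Fin.cons U (i ∘ j.succAbove)) u y =
        ℓ (sectionEval u hu (c i)) y := by
    simp_rw [hfin, Finset.smul_sum]
    rw [Finset.sum_comm, ← logCochain_of_mem ℓ c hu,
      ← one_mul (logCochain ℓ c i u y), ← ρ.sum_finsupport u (Set.mem_univ u), Finset.sum_mul]
    refine Finset.sum_congr rfl fun U hU => ?_
    have hU' : u ∈ (U : Opens X) :=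
      hρ U (subset_tsupport _ ((ρ.mem_finsupport _).1 hU))
    rw [← sum_logCochain_cons ℓ hc i hU' hu, Finset.mul_sum]
    refine Finset.sum_congr rfl fun j _ => ?_
    rw [zsmul_eq_mul]
    push_cast
    ring
  rw [← hsum, sectionEval_d]
  let E : Additive (DMap M Circle) →+ Additive Circle := MonoidHom.toAdditive (DMap.evalHom Circle y)
  refine congrArg Additive.toMul (?_ : E _ = Circle.expHom _)
  rw [map_sum, map_sum]
  simp_rw [map_zsmul]
  rfl

end Cochains

/-! ### Evaluation on cohomology -/

section CoverCohomology

open CategoryTheory Opposite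

variable {X : Type u} [TopologicalSpace X] [DiffeologicalSpace X]
  {M : Type u} [DiffeologicalSpace M]

theorem coverCoeffMap_eval_surjective (x : M) (𝒰 : OpenCover X) (k : ℕ) :
    Function.Surjective (Cech.coverCoeffMap (evalSmoothFunctions X M Circle x) k 𝒰) := fun z =>
  ⟨Cech.coverCoeffMap (constSmoothFunctions X M Circle) k 𝒰 z, by
    induction z using QuotientAddGroup.induction_on
    rfl⟩

/-- A cocycle `c` is the sum of the coboundary of `contractCochain`, which is `c / c(x)`, and the
cocycle `c(x)` of constant maps; the latter is a coboundary as soon as `ev_x c` is one. -/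
theorem coverCoeffMap_eval_injective {n : ℕ} [ChartedSpace (EuclideanSpace ℝ (Fin n)) X]
    [IsManifold (𝓡 n) ∞ X] [T2Space X] [SigmaCompactSpace X]
    (hX : ∀ {k : ℕ} {p : EuclideanSpace ℝ (Fin k) → X}, IsPlot p ↔ ContMDiff (𝓡 k) (𝓡 n) ∞ p)
    (x : M) (ℓ : Additive (DMap M Circle) →+ (M → ℝ))
    (hℓ : ∀ {k : ℕ} {P : EuclideanSpace ℝ (Fin k) → DMap M Circle}, IsPlot P →
      ∀ {q : EuclideanSpace ℝ (Fin k) → M}, IsPlot q →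
        ContDiff ℝ ∞ fun t => ℓ (Additive.ofMul (P t)) (q t))
    (hexp : ∀ (f : DMap M Circle) (y : M),
      Circle.exp (ℓ (Additive.ofMul f) y) = f.toFun y / f.toFun x)
    (𝒰 : OpenCover X) (k : ℕ) :
    Function.Injective (Cech.coverCoeffMap (evalSmoothFunctions X M Circle x) (k + 1) 𝒰) := by
  obtain ⟨ρ, hρ⟩ := SmoothPartitionOfUnity.exists_isSubordinate (𝓡 n) (isClosed_univ (X := X))
    (fun U : 𝒰.sets => ((U : Opens X) : Set X)) (fun U => (U : Opens X).isOpen)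
    (fun u _ => by
      obtain ⟨U, hU, hu⟩ := 𝒰.covers u
      exact Set.mem_iUnion.2 ⟨⟨U, hU⟩, hu⟩)
  rw [injective_iff_map_eq_zero]
  intro z hz
  induction z using QuotientAddGroup.induction_on with | H z =>
  obtain ⟨c, hc⟩ := z
  have hmem := AddSubgroup.mem_addSubgroupOf.1 ((QuotientAddGroup.eq_zero_iff _).1 hz)
  refine (QuotientAddGroup.eq_zero_iff _).2 (AddSubgroup.mem_addSubgroupOf.2 ?_)
  obtain ⟨b, hb : Cech.d _ 𝒰 k b = Cech.coeffCochain (evalSmoothFunctions X M Circle x) 𝒰 _ c⟩ :=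
    hmem
  refine ⟨contractCochain hX ℓ hℓ ρ hρ c +
    Cech.coeffCochain (constSmoothFunctions X M Circle) 𝒰 k b, ?_⟩
  rw [map_add, Cech.d_coeffCochain, hb]
  funext i
  refine sectionEval_ext fun u hu => DMap.ext (funext fun y => ?_)
  have h := (d_contractCochain hX ℓ hℓ ρ hρ hc i hu y).trans (hexp _ y)
  -- the second summand contributes the constant `c_i(u)(x)`
  exact (congrArg (· * _) h).trans (div_mul_cancel _ _)

theorem Cech.map_bijective_of_coverCoeffMap {X : Type u} [TopologicalSpace X]
    {F G : (Opens X)ᵒᵖ ⥤ AddCommGrpCat.{w}} (φ : F ⟶ G) (k : ℕ)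
    (h : ∀ 𝒰, Function.Bijective (Cech.coverCoeffMap φ k 𝒰)) :
    Function.Bijective (Cech.map φ k) := by
  classical
  exact (AddCommGroup.DirectLimit.congr (fun 𝒰 => AddEquiv.ofBijective _ (h 𝒰))
    (Cech.coverCoeffMap_refine φ k)).bijective

end CoverCohomology

theorem mainTheorem7 {m n : ℕ}
    (M : Type u) [TopologicalSpace M] [ChartedSpace (EuclideanSpace ℝ (Fin m)) M]
    [IsManifold (𝓡 m) ∞ M] [T2Space M] [SecondCountableTopology M]
    (hM : IsNConnected 2 M) (x : M)
    (X : Type u) [TopologicalSpace X] [ChartedSpace (EuclideanSpace ℝ (Fin n)) X]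
    [IsManifold (𝓡 n) ∞ X] [T2Space X] [SecondCountableTopology X]
    (k : ℕ) (hk : 0 < k) :
    letI : DiffeologicalSpace M := manifoldDiffeology m M
    letI : DiffeologicalSpace X := manifoldDiffeology n X
    Function.Bijective
      (Cech.map (evalSmoothFunctions X M Circle x) k :
        Cech.Cohomology (smoothFunctions X (DMap M Circle)) k →+
          Cech.Cohomology (smoothFunctions X Circle) k) := by
  let : DiffeologicalSpace M := manifoldDiffeology m M
  let : DiffeologicalSpace X := manifoldDiffeology n X
  obtain ⟨k, rfl⟩ := Nat.exists_eq_add_one.2 hk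
  have := hM.1
  have := simplyConnectedSpace_of_subsingleton_pi_one (hM.2 1 le_rfl one_le_two)
  have : LocallyCompactSpace X :=
    ChartedSpace.locallyCompactSpace (EuclideanSpace ℝ (Fin n)) X
  have hMp : ∀ {l : ℕ} {p : EuclideanSpace ℝ (Fin l) → M},
    IsPlot p ↔ ContMDiff (𝓡 l) (𝓡 m) ∞ p := Iff.rfl
  refine Cech.map_bijective_of_coverCoeffMap _ _ fun 𝒰 =>
    ⟨coverCoeffMap_eval_injective (n := n) Iff.rfl x
      (AddMonoidHom.mk' (fun f => angle x f.toMul) fun f g => angle_mul x hMp f.toMul g.toMul)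
      (contDiff_angle x hMp) (fun f => (angle_spec x hMp f).2.2) 𝒰 k,
    coverCoeffMap_eval_surjective x 𝒰 _⟩
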